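/- Let $\mathcal X$, $\mathcal Y$ be measurable spaces (inputs and labels), let $\mathcal Y'$ be a set of predictions, let $\ell:\mathcal Y'\times\mathcal Y\to\{0,1\}$ be a binary loss, and let $\mathcal G=\{a,b\}$ be the set of values of a binary sensitive attribute. Let $\mathcal D$ be a probability distribution on $\mathcal X\times\mathcal G\times\mathcal Y$, and let $\mathcal H$ be a set of classifiers $h:\mathcal X\to\mathcal Y'$, equipped with a $\sigma$-algebra such that $(h,x,y)\mapsto\ell(h(x),y)$ is measurable. For $g\in\mathcal G$ let $\mathcal D_{|g}$ be the conditional distribution of $(x,y)$ given that the sensitive attribute equals $g$. For a probability measure $\rho$ on $\mathcal H$ define the group Gibbs risks and the fairness risk of the Gibbs classifier $G_\rho$ by $$R_{\mathcal D_{|g}}(G_\rho)=\mathop{\mathbb E}_{h\sim\rho}\ \mathop{\mathbb E}_{(x,y)\sim\mathcal D_{|g}}\ell(h(x),y),\qquad F_{\mathcal D}(G_\rho)=\bigl|R_{\mathcal D_{|a}}(G_\rho)-R_{\mathcal D_{|b}}(G_\rho)\bigr| .$$ For a sample $S=\{(x_i,g_i,y_i)\}_{i=1}^m$ let $m_g=\#\{i: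 g_i=g\}$ and, if $m_g\ge 1$, let $$\widehat R_{S_{|g}}(G_\rho)=\mathop{\mathbb E}_{h\sim\rho}\ \frac1{m_g}\sum_{i:\,g_i=g}\ell(h(x_i),y_i).$$ **Theorem.** For all $\mathcal X,\mathcal Y,\mathcal Y',\ell,\mathcal D,\mathcal H$ as above, every prior probability measure $\pi$ on $\mathcal H$, every $\delta\in(0,1]$ and every $m$, with probability at least $1-\delta$ over the random choice of an i.i.d. sample $S\sim\mathcal D^m$, the following holds: if both groups occur in $S$ (that is, $m_a\ge1$ and $m_b\ge1$), then for every probability measure $\rho$ on $\mathcal H$ simultaneously, $$F_{\mathcal D}(G_\rho)\ \le\ \bigl|\widehat R_{S_{|b}}(G_\rho)-\widehat R_{S_{|a}}(G_\rho)\bigr|+\sqrt{\frac{\mathrm{KL}(\rho\|\pi)+\ln\frac{4\sqrt{m_a}}{\delta}}{2m_a}}+\sqrt{\frac{\mathrm{KL}(\rho\|\pi)+\ln\frac{4\sqrt{m_b}}{\delta}}{2m_b}} ,$$ where $\mathrm{KL}(\rho\|\pi)$ is the Kullback–Leibler divergence, and the right-hand side is $+\infty$ when $\mathrm{KL}(\rho\|\pi)=+\infty$.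 (If $\mathcal D$ gives probability $0$ to a group, so that $\mathcal D_{|g}$ is not defined, then almost surely that group does not occur in $S$ and nothing is claimed.) -/

import Mathlib

open MeasureTheory ProbabilityTheory InformationTheory

/-- The two values of the binary sensitive attribute. -/
inductive SensitiveGroup : Type where
  | a : SensitiveGroup
  | b : SensitiveGroup
  deriving DecidableEq

instance : MeasurableSpace SensitiveGroup := ⊤

namespace FairRisk

noncomputable section

universe u v w

variable {X : Type u} {Y : Type v} {Y' : Type w}

/-- The true risk `E_{(x,y) ∼ P} ℓ(h(x), y)` of a classifier `h` on the distribution `P`. -/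
def risk [MeasurableSpace X] [MeasurableSpace Y] (l : Y' → Y → ℝ)
    (P : Measure (X × Y)) (h : X → Y') : ℝ :=
  ∫ z, l (h z.1) z.2 ∂P

/-- The conditional distribution of `(x, y)` given that the sensitive attribute equals `g`,
when `(x, g, y) ∼ D`. -/
def groupDist [MeasurableSpace X] [MeasurableSpace Y]
    (D : Measure (X × SensitiveGroup × Y)) (g : SensitiveGroup) : Measure (X × Y) :=
  (D[|{z | z.2.1 = g}]).map (fun z => (z.1, z.2.2))

/-- The indices of the examples of the sample `S` that belong to the group `g`. -/
def groupIdx {m : ℕ} (S : Fin m → X × SensitiveGroup × Y) (g : SensitiveGroup) :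
    Finset (Fin m) :=
  Finset.univ.filter (fun i => (S i).2.1 = g)

/-- `m_g`, the number of examples of the sample `S` that belong to the group `g`. -/
def groupSize {m : ℕ} (S : Fin m → X × SensitiveGroup × Y) (g : SensitiveGroup) : ℕ :=
  (groupIdx S g).card

/-- The empirical risk of a classifier `h` on the part of the sample `S` in the group `g`. -/
def groupEmpRisk (l : Y' → Y → ℝ) {m : ℕ} (S : Fin m → X × SensitiveGroup × Y)
    (g : SensitiveGroup) (h : X → Y') : ℝ :=
  (1 / (groupSize S g : ℝ)) * ∑ i ∈ groupIdx S g, l (h (S i).1) (S i).2.2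

/-- The Gibbs risk `E_{h ∼ ρ} E_{(x,y) ∼ P} ℓ(h(x), y)`. -/
def gibbsRisk [MeasurableSpace X] [MeasurableSpace Y] (l : Y' → Y → ℝ)
    (P : Measure (X × Y)) {H : Set (X → Y')} [MeasurableSpace H] (ρ : Measure H) : ℝ :=
  ∫ h, risk l P (h : X → Y') ∂ρ

/-- The empirical Gibbs risk on the part of the sample `S` in the group `g`. -/
def groupGibbsEmpRisk (l : Y' → Y → ℝ) {m : ℕ} (S : Fin m → X × SensitiveGroup × Y)
    (g : SensitiveGroup) {H : Set (X → Y')} [MeasurableSpace H] (ρ : Measure H) : ℝ :=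
  ∫ h, groupEmpRisk l S g (h : X → Y') ∂ρ

/-- The true fairness risk of the Gibbs classifier: the absolute difference between its
true risks on the two groups. -/
def gibbsFairRisk [MeasurableSpace X] [MeasurableSpace Y] (l : Y' → Y → ℝ)
    (D : Measure (X × SensitiveGroup × Y)) {H : Set (X → Y')} [MeasurableSpace H]
    (ρ : Measure H) : ℝ :=
  |gibbsRisk l (groupDist D SensitiveGroup.a) ρ
    - gibbsRisk l (groupDist D SensitiveGroup.b) ρ|

end

end FairRisk

/-! The theorem follows from a PAC-Bayes bound for each group at confidence `δ / 2`, a union bound,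
and the triangle inequality. The difficulty is that the group size `n = m_g` is random. It is
handled without conditioning on the group memberships.

Fix a classifier with risk `p` on the group, and let `a` and `b` count its losses 1 and 0 there. The
likelihood ratio of the Krichevsky–Trofimov mixture to Bernoulli(`p`), `ktProb a b / (p ^ a * (1 -
p) ^ b)`, starts at 1, does not change when an example of the other group is drawn, and does not
grow in mean otherwise. Its mean over the whole sample is therefore at most 1
(`lintegral_exp_sq_countIn_le`). The mixture is within a factor `2 √n` of the maximum likelihood
(`pow_mul_pow_le_ktProb`), and by Pinsker the maximum likelihood exceeds the likelihood at `p` by a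
factor of at least `exp (2 n (a / n - p) ^ 2)` (`pow_mul_pow_mul_exp_le`). So `exp (2 n (a / n - p)
^ 2) / (2 √n)` has mean at most 1, even with `n` random.

Tonelli and Markov make the prior average of this quantity less than `2 / δ` outside an event of
probability at most `δ / 2`. Donsker–Varadhan and Jensen then pass from the prior to every posterior
at once (`abs_integral_le_sqrt`). -/

namespace FairRisk

/-! ### Regret of the Krichevsky–Trofimov mixture -/

/-- The Krichevsky–Trofimov probability of a binary word with `a` ones and `b` zeros. -/
noncomputable def ktProb (a b : ℕ) : ℝ :=
  (∏ i ∈ Finset.range a, ((i : ℝ) + 1 / 2)) * (∏ i ∈ Finset.range b, ((i : ℝ) + 1 / 2))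
    / ((a + b).factorial : ℝ)

theorem ktProb_comm (a b : ℕ) : ktProb a b = ktProb b a := by
  rw [ktProb, ktProb, mul_comm, add_comm]

theorem ktProb_pos (a b : ℕ) : 0 < ktProb a b := by
  refine div_pos (mul_pos (Finset.prod_pos fun i _ => ?_) (Finset.prod_pos fun i _ => ?_)) ?_
  all_goals positivity

theorem ktProb_zero_zero : ktProb 0 0 = 1 := by simp [ktProb]

/-- Sequential form of the mixture: after `a` ones and `b` zeros, the next symbol is predicted to be
one with probability `(a + 1/2) / (a + b + 1)`. -/
theorem ktProb_succ_left (a b : ℕ) :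
    ((a : ℝ) + b + 1) * ktProb (a + 1) b = (a + 1 / 2) * ktProb a b := by
  have h : (a + 1 + b).factorial = (a + b + 1) * (a + b).factorial := by
    rw [show a + 1 + b = (a + b) + 1 by ring, Nat.factorial_succ]
  have h2 : ((a + b).factorial : ℝ) ≠ 0 := by positivity
  have h3 : ((a : ℝ) + b + 1) ≠ 0 := by positivity
  rw [ktProb, ktProb, Finset.prod_range_succ, h]
  push_cast
  generalize ∏ i ∈ Finset.range a, ((i : ℝ) + 1 / 2) = P
  field_simp

/-- The predictions for one and zero sum to 1; this is what makes the likelihood ratio a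
supermartingale. -/
theorem ktProb_add_ktProb (a b : ℕ) :
    ktProb (a + 1) b + ktProb a (b + 1) = ktProb a b := by
  have h1 := ktProb_succ_left a b
  have h2 := ktProb_succ_left b a
  rw [ktProb_comm (b + 1) a, ktProb_comm b a] at h2
  have h3 : (0 : ℝ) < (a : ℝ) + b + 1 := by positivity
  refine mul_left_cancel₀ h3.ne' ?_
  linarith

/-- This is `t ≤ sinh t` at `t = log y`. -/
theorem two_mul_log_le_sub_inv {y : ℝ} (hy : 1 ≤ y) : 2 * Real.log y ≤ y - y⁻¹ := by
  have h := Real.self_le_sinh_iff.2 (Real.log_nonneg hy)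
  rw [Real.sinh_eq, Real.exp_neg, Real.exp_log (by linarith)] at h
  linarith

/-- In logarithms, `(n + 1/2) log (1 + 1/n) ≥ 1`, which is `log (1 + x) ≥ 2x / (x + 2)` at `x =
1/n`. -/
theorem exp_one_mul_pow_mul_sqrt_le {n : ℕ} (hn : 1 ≤ n) :
    Real.exp 1 * ((n : ℝ) ^ n * √n) ≤ ((n : ℝ) + 1) ^ n * √((n : ℝ) + 1) := by
  have hn0 : (0 : ℝ) < n := by exact_mod_cast hn
  rw [← Real.log_le_log_iff (by positivity) (by positivity),
    Real.log_mul (by positivity) (by positivity), Real.log_mul (by positivity) (by positivity),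
    Real.log_mul (by positivity) (by positivity), Real.log_exp, Real.log_pow, Real.log_pow,
    Real.log_sqrt hn0.le, Real.log_sqrt (by positivity)]
  have h := Real.le_log_one_add_of_nonneg (x := 1 / (n : ℝ)) (by positivity)
  have h1 : Real.log (1 + 1 / (n : ℝ)) = Real.log (n + 1) - Real.log n := by
    rw [← Real.log_div (by positivity) (by positivity)]
    congr 1
    field_simp
  have h2 : 2 * (1 / (n : ℝ)) / (1 / n + 2) = 2 / (1 + 2 * n) := by field_simp
  rw [h1, h2, div_le_iff₀ (by positivity)] at h
  linarith

/-- In logarithms, `a log (1 + 1/a) + log ((a + 1) / (a + 1/2)) ≤ 1`. Both terms are bounded by the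
`sinh` inequality, the first after writing `1 + 1/a` as a square. -/
theorem succ_pow_succ_le (a : ℕ) :
    ((a : ℝ) + 1) ^ (a + 1) ≤ Real.exp 1 * ((a : ℝ) ^ a * (a + 1 / 2)) := by
  rcases Nat.eq_zero_or_pos a with rfl | ha
  · have := Real.add_one_le_exp (1 : ℝ)
    norm_num at this ⊢
    linarith
  have ha0 : (0 : ℝ) < a := by exact_mod_cast ha
  rw [← Real.log_le_log_iff (by positivity) (by positivity),
    Real.log_mul (by positivity) (by positivity), Real.log_mul (by positivity) (by positivity),
    Real.log_exp, Real.log_pow, Real.log_pow]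
  push_cast
  -- With this `s`, `(a + 1) / (a + 1/2) = 1 + s` and `a / (a + 1) = (1 - s) / (1 + s)`, so both
  -- terms depend on `s` alone.
  set s : ℝ := 1 / (2 * a + 1) with hs
  have hs0 : 0 < s := by positivity
  have h1 := two_mul_log_le_sub_inv (y := 1 + s) (by linarith)
  have h2 := two_mul_log_le_sub_inv (y := √(1 + 1 / a))
    (by rw [Real.one_le_sqrt]; linarith [show 0 < 1 / (a : ℝ) by positivity])
  rw [Real.log_sqrt (by positivity)] at h2
  have e1 : Real.log (1 + s) = Real.log (a + 1) - Real.log (a + 1 / 2) := by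
    rw [← Real.log_div (by positivity) (by positivity)]
    congr 1
    rw [hs]
    field_simp
    ring
  have e2 : Real.log (1 + 1 / (a : ℝ)) = Real.log (a + 1) - Real.log a := by
    rw [← Real.log_div (by positivity) (by positivity)]
    congr 1
    field_simp
  rw [e1] at h1
  rw [e2] at h2
  set y : ℝ := √(1 + 1 / a) with hy
  have hy0 : 0 < y := by positivity
  have hy2 : y ^ 2 = 1 + 1 / a := Real.sq_sqrt (by positivity)
  have hay : (a : ℝ) * (y - y⁻¹) = y⁻¹ := by
    have : (a : ℝ) * y ^ 2 = a + 1 := by rw [hy2]; field_simp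
    field_simp
    linarith
  -- weighted AM-GM for `y⁻¹ = √(a / (a + 1))`
  have hyinv : y⁻¹ ≤ (1 - s ^ 2 / 2) / (1 + s) := by
    have hz : (y⁻¹) ^ 2 = (1 - s) / (1 + s) := by
      rw [inv_pow, hy2, hs]
      field_simp
      ring
    have hs1 : s ≤ 1 := by
      rw [hs, div_le_one (by positivity)]
      linarith
    refine le_of_sq_le_sq ?_ ?_
    · rw [hz, div_pow, div_le_div_iff₀ (by positivity) (by positivity)]
      nlinarith [mul_nonneg (by positivity : 0 ≤ s ^ 4) (by positivity : 0 ≤ 1 + s)]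
    · apply div_nonneg <;> nlinarith
  -- The two upper bounds add up to exactly 1.
  have h3 : (1 - s ^ 2 / 2) / (1 + s) + (1 + s - (1 + s)⁻¹) / 2 = 1 := by
    field_simp
    ring
  have h4 : (a : ℝ) * (Real.log (a + 1) - Real.log a) ≤ y⁻¹ := by
    rw [← hay]
    exact mul_le_mul_of_nonneg_left (by linarith) ha0.le
  linarith

/-- One more one multiplies `a ^ a` by at most `e (a + 1/2)` and `ktProb` by `(a + 1/2) / (a + b +
1)`. The remaining `e` is absorbed by the growth of `n ^ n * √n`. -/
theorem pow_mul_pow_le_ktProb_succ {a b : ℕ} (hab : 1 ≤ a + b)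
    (ih : (a : ℝ) ^ a * (b : ℝ) ^ b
      ≤ 2 * √((a : ℝ) + b) * ((a : ℝ) + b) ^ (a + b) * ktProb a b) :
    ((a : ℝ) + 1) ^ (a + 1) * (b : ℝ) ^ b
      ≤ 2 * √((a : ℝ) + b + 1) * ((a : ℝ) + b + 1) ^ (a + b + 1) * ktProb (a + 1) b := by
  have h1 := succ_pow_succ_le a
  have h2 := exp_one_mul_pow_mul_sqrt_le hab
  push_cast at h2
  have hk := ktProb_pos (a + 1) b
  calc ((a : ℝ) + 1) ^ (a + 1) * (b : ℝ) ^ b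
      ≤ Real.exp 1 * ((a : ℝ) ^ a * (a + 1 / 2)) * (b : ℝ) ^ b := by gcongr
    _ = Real.exp 1 * (a + 1 / 2) * ((a : ℝ) ^ a * (b : ℝ) ^ b) := by ring
    _ ≤ Real.exp 1 * (a + 1 / 2)
          * (2 * √((a : ℝ) + b) * ((a : ℝ) + b) ^ (a + b) * ktProb a b) := by gcongr
    _ = Real.exp 1 * (((a : ℝ) + b) ^ (a + b) * √((a : ℝ) + b))
          * (2 * ((a + 1 / 2) * ktProb a b)) := by ring
    _ = Real.exp 1 * (((a : ℝ) + b) ^ (a + b) * √((a : ℝ) + b))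
          * (2 * (((a : ℝ) + b + 1) * ktProb (a + 1) b)) := by rw [ktProb_succ_left]
    _ ≤ ((a : ℝ) + b + 1) ^ (a + b) * √((a : ℝ) + b + 1)
          * (2 * (((a : ℝ) + b + 1) * ktProb (a + 1) b)) := by gcongr
    _ = _ := by ring

/-- The regret of the Krichevsky–Trofimov estimator is at most `2 √n`. -/
theorem pow_mul_pow_le_ktProb (n : ℕ) : ∀ a b : ℕ, a + b = n + 1 →
    (a : ℝ) ^ a * (b : ℝ) ^ b ≤ 2 * √((a : ℝ) + b) * ((a : ℝ) + b) ^ (a + b) * ktProb a b := by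
  induction n with
  | zero =>
    intro a b hab
    have : (a = 0 ∧ b = 1) ∨ (a = 1 ∧ b = 0) := by omega
    -- Equality holds here, since a single symbol has mixture probability 1/2; this is the source of
    -- the constant 2.
    rcases this with ⟨rfl, rfl⟩ | ⟨rfl, rfl⟩ <;> norm_num [ktProb]
  | succ n ih =>
    intro a b hab
    rcases a with _ | a
    · obtain ⟨b, rfl⟩ : ∃ c, b = c + 1 := ⟨b - 1, by omega⟩
      have h := pow_mul_pow_le_ktProb_succ (a := b) (b := 0) (by omega) (ih b 0 (by omega))
      rw [ktProb_comm]
      simpa using h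
    · have h := pow_mul_pow_le_ktProb_succ (a := a) (b := b) (by omega) (ih a b (by omega))
      push_cast
      rw [show (a : ℝ) + 1 + b = a + b + 1 by ring, show a + 1 + b = a + b + 1 by ring]
      exact h

/-! ### Pinsker's inequality and the pointwise bound -/

/-- Pinsker's inequality for Bernoulli distributions, in exponential form. -/
theorem pow_mul_pow_mul_exp_le {a b : ℕ} (hab : 1 ≤ a + b) {p : ℝ} (hp0 : 0 ≤ p) (hp1 : p ≤ 1) :
    p ^ a * (1 - p) ^ b * Real.exp (2 * ((a : ℝ) + b) * (a / ((a : ℝ) + b) - p) ^ 2)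
      ≤ ((a : ℝ) / (a + b)) ^ a * ((b : ℝ) / (a + b)) ^ b := by
  have hn : (0 : ℝ) < (a : ℝ) + b := by exact_mod_cast hab
  set n : ℝ := (a : ℝ) + b with hn_def
  set q : ℝ := a / n with hq
  -- The frequency `q` is fixed and the parameter varies: `F` peaks at `q`, where the exponential
  -- factor is 1.
  set F : ℝ → ℝ := fun x => x ^ a * (1 - x) ^ b * Real.exp (2 * n * (q - x) ^ 2) with hF
  have hq0 : 0 ≤ q := by positivity
  have hq1 : q ≤ 1 := by
    rw [hq, div_le_one hn, hn_def]
    linarith [Nat.cast_nonneg (α := ℝ) b]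
  have hnq : n * q = a := by rw [hq]; field_simp
  have hb : (b : ℝ) / n = 1 - q := by
    rw [hq, eq_sub_iff_add_eq, ← add_div, div_eq_one_iff_eq hn.ne', hn_def]
    ring
  set F' : ℝ → ℝ := fun x => ((a * x ^ (a - 1)) * (1 - x) ^ b + x ^ a * (b * (1 - x) ^ (b - 1) * (-1)))
    * Real.exp (2 * n * (q - x) ^ 2)
      + x ^ a * (1 - x) ^ b * (Real.exp (2 * n * (q - x) ^ 2) * (2 * n * (2 * (q - x) * (-1)))) with hF'
  have hderiv : ∀ x, HasDerivAt F (F' x) x := by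
    intro x
    have h1 : HasDerivAt (fun x : ℝ => 1 - x) (-1) x := by
      simpa using (hasDerivAt_id x).const_sub 1
    have h2 : HasDerivAt (fun x : ℝ => q - x) (-1) x := by
      simpa using (hasDerivAt_id x).const_sub q
    have h3 := ((hasDerivAt_pow a x).mul (h1.pow b)).mul (((h2.pow 2).const_mul (2 * n)).exp)
    refine h3.congr_deriv ?_
    simp only [hF', Pi.mul_apply, Pi.pow_apply, Nat.cast_ofNat]
    ring
  have hcont : ∀ s, ContinuousOn F s := fun s x _ => (hderiv x).continuousAt.continuousWithinAt
  -- The factor `x (1 - x)` removes the truncated exponents `a - 1` and `b - 1`. Since `1 - 4 x (1 -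
  -- x) = (1 - 2 x) ^ 2`, the derivative changes sign only at `q`.
  have hkey : ∀ x, x * (1 - x) * F' x
      = n * (q - x) * (1 - 2 * x) ^ 2
        * (x ^ a * (1 - x) ^ b * Real.exp (2 * n * (q - x) ^ 2)) := by
    intro x
    have h1 : x * (a * x ^ (a - 1)) = a * x ^ a := by
      rcases a with _ | a
      · simp
      · simp [pow_succ]; ring
    have h2 : (1 - x) * (b * (1 - x) ^ (b - 1)) = b * (1 - x) ^ b := by
      rcases b with _ | b
      · simp
      · simp [pow_succ]; ring
    have hb' : (b : ℝ) = n * (1 - q) := by rw [← hb]; field_simp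
    calc x * (1 - x) * F' x
        = ((x * (a * x ^ (a - 1))) * (1 - x) * (1 - x) ^ b
            - x * x ^ a * ((1 - x) * (b * (1 - x) ^ (b - 1))))
            * Real.exp (2 * n * (q - x) ^ 2)
          - x * (1 - x) * (x ^ a * (1 - x) ^ b
            * Real.exp (2 * n * (q - x) ^ 2) * (4 * n * (q - x))) := by
          simp only [hF']; ring
      _ = (a * (1 - x) - b * x - x * (1 - x) * (4 * n * (q - x)))
            * (x ^ a * (1 - x) ^ b * Real.exp (2 * n * (q - x) ^ 2)) := by
          rw [h1, h2]; ring
      _ = _ := by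
          rw [hb', ← hnq]; ring
  have hmain : F p ≤ F q := by
    rcases le_total p q with h | h
    · have hm : MonotoneOn F (Set.Icc 0 q) := by
        refine monotoneOn_of_deriv_nonneg (convex_Icc _ _) (hcont _)
          (fun x _ => (hderiv x).differentiableAt.differentiableWithinAt) ?_
        intro x hx
        rw [interior_Icc] at hx
        have hx1 : 0 < 1 - x := by linarith [hx.2]
        rw [(hderiv x).deriv]
        refine (mul_nonneg_iff_of_pos_left (mul_pos hx.1 hx1)).1 ?_
        rw [hkey x]
        have := hx.1
        have : 0 < q - x := by linarith [hx.2]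
        positivity
      exact hm ⟨hp0, h⟩ ⟨hq0, le_rfl⟩ h
    · have hm : AntitoneOn F (Set.Icc q 1) := by
        refine antitoneOn_of_deriv_nonpos (convex_Icc _ _) (hcont _)
          (fun x _ => (hderiv x).differentiableAt.differentiableWithinAt) ?_
        intro x hx
        rw [interior_Icc] at hx
        have hx1 : 0 < 1 - x := by linarith [hx.2]
        have hx0 : 0 < x := by linarith [hx.1]
        rw [(hderiv x).deriv]
        by_contra hneg
        have h1 := mul_pos (mul_pos hx0 hx1) (not_le.1 hneg)
        rw [hkey x] at h1
        have h2 : 0 ≤ n * (x - q) * (1 - 2 * x) ^ 2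
            * (x ^ a * (1 - x) ^ b * Real.exp (2 * n * (q - x) ^ 2)) := by
          have : 0 < x - q := by linarith [hx.1]
          positivity
        linarith
      exact hm ⟨le_rfl, hq1⟩ ⟨h, hp1⟩ h
  rw [hb]
  simpa [hF] using hmain

theorem exp_div_mul_pow_le_ktProb {a b : ℕ} {p : ℝ} (hp0 : 0 ≤ p) (hp1 : p ≤ 1) :
    Real.exp (2 * ((a : ℝ) + b) * (a / ((a : ℝ) + b) - p) ^ 2) / (2 * √((a : ℝ) + b))
      * (p ^ a * (1 - p) ^ b) ≤ ktProb a b := by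
  -- With no observations the division by `√0` yields 0, so the bound is trivial.
  rcases Nat.eq_zero_or_pos (a + b) with h0 | hab
  · obtain ⟨rfl, rfl⟩ : a = 0 ∧ b = 0 := by omega
    simpa using (ktProb_pos 0 0).le
  have hn : (0 : ℝ) < (a : ℝ) + b := by exact_mod_cast hab
  have h1 := pow_mul_pow_mul_exp_le (by omega) hp0 hp1 (a := a) (b := b)
  have h2 := pow_mul_pow_le_ktProb (a + b - 1) a b (by omega)
  rw [div_mul_eq_mul_div, div_le_iff₀ (by positivity)]
  calc _ = p ^ a * (1 - p) ^ b
        * Real.exp (2 * ((a : ℝ) + b) * (a / ((a : ℝ) + b) - p) ^ 2) := by ring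
    _ ≤ _ := h1
    _ = ((a : ℝ) ^ a * (b : ℝ) ^ b) / ((a : ℝ) + b) ^ (a + b) := by
        rw [div_pow, div_pow, pow_add]; field_simp
    _ ≤ _ := by
        rw [div_le_iff₀ (by positivity)]
        linarith

/-! ### The likelihood-ratio supermartingale -/

section Supermartingale

variable {Z : Type*} [MeasurableSpace Z]

/-- The number of entries of `S` that lie in `A`. -/
noncomputable def countIn {m : ℕ} (A : Set Z) (S : Fin m → Z) : ℕ :=
  ∑ i, A.indicator (fun _ => 1) (S i)

theorem measurable_countIn {m : ℕ} {A : Set Z} (hA : MeasurableSet A) :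
    Measurable (countIn A : (Fin m → Z) → ℕ) :=
  Finset.measurable_sum _ fun i _ =>
    (measurable_const.indicator hA).comp (measurable_pi_apply i)

/-- If drawing one more example does not increase the mean of `W`, then neither does drawing `m`
more examples. -/
theorem lintegral_countIn_le {D : Measure Z} [IsProbabilityMeasure D] {A B : Set Z}
    (hA : MeasurableSet A) (hB : MeasurableSet B) (hAB : Disjoint A B) (W : ℕ → ℕ → ENNReal)
    (hW : ∀ a b, D A * W (a + 1) b + D B * W a (b + 1) + D (A ∪ B)ᶜ * W a b ≤ W a b) (m : ℕ) :
    ∀ a b, ∫⁻ S : Fin m → Z, W (a + countIn A S) (b + countIn B S) ∂(Measure.pi fun _ => D)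
      ≤ W a b := by
  induction m with
  | zero => intro a b; simp [countIn]
  | succ m ih =>
    intro a b
    have hmW : Measurable (fun q : ℕ × ℕ => W q.1 q.2) := measurable_of_countable _
    let F : Z × (Fin m → Z) → ENNReal := fun q =>
      W (a + (A.indicator (fun _ => 1) q.1 + countIn A q.2))
        (b + (B.indicator (fun _ => 1) q.1 + countIn B q.2))
    have hF : Measurable F := by
      refine hmW.comp (Measurable.prodMk ?_ ?_)
      · exact ((measurable_const.indicator hA).comp measurable_fst |>.add
          ((measurable_countIn hA).comp measurable_snd)).const_add a
      · exact ((measurable_const.indicator hB).comp measurable_fst |>.add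
          ((measurable_countIn hB).comp measurable_snd)).const_add b
    have h1 : ∫⁻ S : Fin (m + 1) → Z, W (a + countIn A S) (b + countIn B S)
        ∂(Measure.pi fun _ => D) = ∫⁻ q, F q ∂(D.prod (Measure.pi fun _ => D)) := by
      -- Coordinate 0 is split off as the first draw. The initial counts are arbitrary, so the
      -- induction hypothesis applies to the updated ones.
      rw [← (measurePreserving_piFinSuccAbove (fun _ : Fin (m + 1) => D) 0).lintegral_comp hF]
      refine lintegral_congr fun S => ?_
      simp only [F, countIn, Fin.sum_univ_succ]
      rfl
    rw [h1, lintegral_prod _ hF.aemeasurable]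
    have h2 : ∀ z, ∫⁻ T, F (z, T) ∂(Measure.pi fun _ : Fin m => D)
        ≤ A.indicator (fun _ => W (a + 1) b) z + B.indicator (fun _ => W a (b + 1)) z
          + (A ∪ B)ᶜ.indicator (fun _ => W a b) z := by
      intro z
      by_cases hzA : z ∈ A
      · have hzB : z ∉ B := Set.disjoint_left.1 hAB hzA
        simpa [F, hzA, hzB, add_assoc] using ih (a + 1) b
      · by_cases hzB : z ∈ B
        · simpa [F, hzA, hzB, add_assoc] using ih a (b + 1)
        · simpa [F, hzA, hzB] using ih a b
    refine (lintegral_mono h2).trans ?_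
    rw [lintegral_add_right _ (measurable_const.indicator (hA.union hB).compl),
      lintegral_add_left (measurable_const.indicator hA), lintegral_indicator_const hA,
      lintegral_indicator_const hB, lintegral_indicator_const (hA.union hB).compl]
    refine le_trans (le_of_eq ?_) (hW a b)
    ring

/-- Cancelling one `p` gives equality unless `p = 0`, when the left side vanishes. -/
theorem mul_div_pow_succ_mul_le {p r x : ENNReal} (hp : p ≠ ⊤) (n : ℕ) :
    p * (x / (p ^ (n + 1) * r)) ≤ x / (p ^ n * r) := by
  rcases eq_or_ne p 0 with rfl | hp0
  · simp
  · refine le_of_eq ?_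
    rw [pow_succ', mul_assoc, ← mul_div_assoc, ENNReal.mul_div_mul_left _ _ hp0 hp]

/-- The exponential moment of the squared deviation of the empirical frequency of `A` within
`A ∪ B` is at most `2 √n`, where `n` is the random number of examples in `A ∪ B`. -/
theorem lintegral_exp_sq_countIn_le {D : Measure Z} [IsProbabilityMeasure D] {A B : Set Z}
    (hA : MeasurableSet A) (hB : MeasurableSet B) (hAB : Disjoint A B) {p : ℝ} (hp0 : 0 ≤ p)
    (hp1 : p ≤ 1) (hDA : D A = D (A ∪ B) * ENNReal.ofReal p)
    (hDB : D B = D (A ∪ B) * ENNReal.ofReal (1 - p)) (m : ℕ) :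
    ∫⁻ S : Fin m → Z, ENNReal.ofReal
        (Real.exp (2 * ((countIn A S : ℝ) + countIn B S)
            * (countIn A S / ((countIn A S : ℝ) + countIn B S) - p) ^ 2)
          / (2 * √((countIn A S : ℝ) + countIn B S))) ∂(Measure.pi fun _ => D) ≤ 1 := by
  let W : ℕ → ℕ → ENNReal := fun a b => ENNReal.ofReal (ktProb a b)
    / (ENNReal.ofReal p ^ a * ENNReal.ofReal (1 - p) ^ b)
  have hW : ∀ a b, D A * W (a + 1) b + D B * W a (b + 1) + D (A ∪ B)ᶜ * W a b ≤ W a b := by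
    intro a b
    have h1 : ENNReal.ofReal p * W (a + 1) b ≤ ENNReal.ofReal (ktProb (a + 1) b)
        / (ENNReal.ofReal p ^ a * ENNReal.ofReal (1 - p) ^ b) :=
      mul_div_pow_succ_mul_le ENNReal.ofReal_ne_top a
    have h2 : ENNReal.ofReal (1 - p) * W a (b + 1) ≤ ENNReal.ofReal (ktProb a (b + 1))
        / (ENNReal.ofReal p ^ a * ENNReal.ofReal (1 - p) ^ b) := by
      have := mul_div_pow_succ_mul_le (p := ENNReal.ofReal (1 - p)) (r := ENNReal.ofReal p ^ a)
        (x := ENNReal.ofReal (ktProb a (b + 1))) ENNReal.ofReal_ne_top b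
      simpa only [W, mul_comm (ENNReal.ofReal p ^ a)] using this
    have h3 : ENNReal.ofReal p * W (a + 1) b + ENNReal.ofReal (1 - p) * W a (b + 1) ≤ W a b := by
      refine (add_le_add h1 h2).trans (le_of_eq ?_)
      rw [← ENNReal.add_div, ← ENNReal.ofReal_add (ktProb_pos _ _).le (ktProb_pos _ _).le,
        ktProb_add_ktProb]
    calc D A * W (a + 1) b + D B * W a (b + 1) + D (A ∪ B)ᶜ * W a b
        = D (A ∪ B) * (ENNReal.ofReal p * W (a + 1) b + ENNReal.ofReal (1 - p) * W a (b + 1))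
          + D (A ∪ B)ᶜ * W a b := by rw [hDA, hDB]; ring
      _ ≤ D (A ∪ B) * W a b + D (A ∪ B)ᶜ * W a b := by gcongr
      _ = W a b := by
        rw [← add_mul, prob_add_prob_compl (hA.union hB), one_mul]
  refine (lintegral_mono fun S => ?_).trans
    ((lintegral_countIn_le hA hB hAB W hW m 0 0).trans (by simp [W, ktProb_zero_zero]))
  simp only [zero_add, W]
  -- The denominator may be 0; positivity of `ktProb` then makes the ratio infinite, and the bound
  -- survives.
  rw [ENNReal.le_div_iff_mul_le
      (Or.inr (by simpa using ktProb_pos (countIn A S) (countIn B S)))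
      (Or.inr ENNReal.ofReal_ne_top),
    ← ENNReal.ofReal_pow hp0, ← ENNReal.ofReal_pow (by linarith),
    ← ENNReal.ofReal_mul (by positivity), ← ENNReal.ofReal_mul (by positivity)]
  exact ENNReal.ofReal_le_ofReal (exp_div_mul_pow_le_ktProb hp0 hp1)

end Supermartingale

/-! ### Change of measure from prior to posterior -/

section ChangeOfMeasure

variable {Ω : Type*} [MeasurableSpace Ω]

/-- The Donsker–Varadhan inequality. -/
theorem integral_le_klDiv_add_log {ρ π : Measure Ω} [IsProbabilityMeasure ρ]
    [IsProbabilityMeasure π] (hkl : klDiv ρ π ≠ ⊤) {f : Ω → ℝ} (hfρ : Integrable f ρ)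
    (hfπ : Integrable (fun x => Real.exp (f x)) π) :
    ∫ x, f x ∂ρ ≤ (klDiv ρ π).toReal + Real.log (∫ x, Real.exp (f x) ∂π) := by
  obtain ⟨hac, hint⟩ := klDiv_ne_top_iff.1 hkl
  have := isProbabilityMeasure_tilted hfπ
  have hac' : ρ ≪ π.tilted f := hac.trans (absolutelyContinuous_tilted hfπ)
  -- The slack in the inequality is the divergence of `ρ` from the tilted prior, which is
  -- nonnegative.
  have h1 := integral_llr_tilted_right hac hfρ hfπ hint
  have h2 := toReal_klDiv_of_measure_eq hac' (by simp)
  have h3 := toReal_klDiv_of_measure_eq hac (by simp)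
  have h4 : 0 ≤ (klDiv ρ (π.tilted f)).toReal := ENNReal.toReal_nonneg
  linarith

theorem sq_integral_le_integral_sq {ρ : Measure Ω} [IsProbabilityMeasure ρ] {f : Ω → ℝ}
    (hf : MemLp f 2 ρ) : (∫ x, f x ∂ρ) ^ 2 ≤ ∫ x, f x ^ 2 ∂ρ := by
  have h1 := variance_eq_sub hf
  have h2 := variance_nonneg f ρ
  simp only [Pi.pow_apply] at h1
  linarith

/-- Donsker–Varadhan for `2 n f ^ 2`, followed by Jensen for the square. In the application `f` is
empirical minus true risk, `n` the group size and `c = 2 / δ`. -/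
theorem abs_integral_le_sqrt {ρ π : Measure Ω} [IsProbabilityMeasure ρ]
    [IsProbabilityMeasure π] (hkl : klDiv ρ π ≠ ⊤) {f : Ω → ℝ} (hf : Measurable f)
    (hf1 : ∀ x, |f x| ≤ 1) {n c : ℝ} (hn : 0 < n) (hc : 0 < c)
    (h : ∫⁻ x, ENNReal.ofReal (Real.exp (2 * n * f x ^ 2) / (2 * √n)) ∂π ≤ ENNReal.ofReal c) :
    |∫ x, f x ∂ρ| ≤ √(((klDiv ρ π).toReal + Real.log (2 * √n * c)) / (2 * n)) := by
  have hsq : ∀ x, f x ^ 2 ≤ 1 := fun x => (sq_le_one_iff_abs_le_one _).2 (hf1 x)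
  have hmeas2 : Measurable (fun x => 2 * n * f x ^ 2) := (hf.pow_const 2).const_mul _
  have hfρ : Integrable (fun x => 2 * n * f x ^ 2) ρ := by
    refine Integrable.of_bound hmeas2.aestronglyMeasurable (2 * n) (ae_of_all _ fun x => ?_)
    rw [Real.norm_of_nonneg (by positivity)]
    exact mul_le_of_le_one_right (by positivity) (hsq x)
  have hfπ : Integrable (fun x => Real.exp (2 * n * f x ^ 2)) π := by
    refine Integrable.of_bound hmeas2.exp.aestronglyMeasurable (Real.exp (2 * n))
      (ae_of_all _ fun x => ?_)
    rw [Real.norm_of_nonneg (by positivity)]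
    exact Real.exp_le_exp.2 (mul_le_of_le_one_right (by positivity) (hsq x))
  have hmem : MemLp f 2 ρ :=
    MemLp.of_bound hf.aestronglyMeasurable 1 (ae_of_all _ fun x => by simpa using hf1 x)
  have hmgf : ∫ x, Real.exp (2 * n * f x ^ 2) ∂π ≤ 2 * √n * c := by
    rw [← ofReal_integral_eq_lintegral_ofReal (hfπ.div_const _)
        (ae_of_all _ fun x => by positivity), ENNReal.ofReal_le_ofReal_iff hc.le,
      integral_div, div_le_iff₀ (by positivity)] at h
    linarith
  have hpos : 0 < ∫ x, Real.exp (2 * n * f x ^ 2) ∂π := integral_exp_pos hfπ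
  have h1 := integral_le_klDiv_add_log hkl hfρ hfπ
  have h2 := Real.log_le_log hpos hmgf
  have h3 := sq_integral_le_integral_sq hmem
  rw [integral_const_mul] at h1
  refine Real.abs_le_sqrt ?_
  rw [le_div_iff₀ (by positivity)]
  nlinarith

end ChangeOfMeasure

/-! ### Group risks as event frequencies and probabilities -/

variable {X Y Y' : Type*}

/-- The examples of group `g` on which the loss of `h` is `c`. -/
def lossEvent (l : Y' → Y → ℝ) (h : X → Y') (g : SensitiveGroup) (c : ℝ) :
    Set (X × SensitiveGroup × Y) :=
  {z | z.2.1 = g ∧ l (h z.1) z.2.2 = c}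

theorem disjoint_lossEvent (l : Y' → Y → ℝ) (h : X → Y') (g : SensitiveGroup) :
    Disjoint (lossEvent l h g 1) (lossEvent l h g 0) := by
  rw [Set.disjoint_left]
  rintro z ⟨_, h1⟩ ⟨_, h0⟩
  exact one_ne_zero (h1.symm.trans h0)

theorem lossEvent_union {l : Y' → Y → ℝ} (hl : ∀ y' y, l y' y = 0 ∨ l y' y = 1) (h : X → Y')
    (g : SensitiveGroup) :
    lossEvent l h g 1 ∪ lossEvent l h g 0 = {z : X × SensitiveGroup × Y | z.2.1 = g} := by
  ext z
  have := hl (h z.1) z.2.2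
  simp only [lossEvent, Set.mem_union, Set.mem_ofPred_eq]
  tauto

theorem countIn_lossEvent_one {l : Y' → Y → ℝ} (hl : ∀ y' y, l y' y = 0 ∨ l y' y = 1)
    (h : X → Y') (g : SensitiveGroup) {m : ℕ} (S : Fin m → X × SensitiveGroup × Y) :
    (countIn (lossEvent l h g 1) S : ℝ) = ∑ i ∈ groupIdx S g, l (h (S i).1) (S i).2.2 := by
  classical
  rw [groupIdx, Finset.sum_filter, countIn]
  push_cast
  refine Finset.sum_congr rfl fun i _ => ?_
  by_cases hg : (S i).2.1 = g <;> rcases hl (h (S i).1) (S i).2.2 with h0 | h0 <;>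
    simp [lossEvent, hg, h0]

theorem countIn_add_countIn {l : Y' → Y → ℝ} (hl : ∀ y' y, l y' y = 0 ∨ l y' y = 1)
    (h : X → Y') (g : SensitiveGroup) {m : ℕ} (S : Fin m → X × SensitiveGroup × Y) :
    countIn (lossEvent l h g 1) S + countIn (lossEvent l h g 0) S = groupSize S g := by
  classical
  rw [groupSize, groupIdx, Finset.card_filter, countIn, countIn, ← Finset.sum_add_distrib]
  refine Finset.sum_congr rfl fun i _ => ?_
  by_cases hg : (S i).2.1 = g <;> rcases hl (h (S i).1) (S i).2.2 with h0 | h0 <;>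
    simp [lossEvent, hg, h0]

theorem groupEmpRisk_mem_Icc {l : Y' → Y → ℝ} (hl : ∀ y' y, l y' y = 0 ∨ l y' y = 1)
    (h : X → Y') {m : ℕ} (S : Fin m → X × SensitiveGroup × Y) (g : SensitiveGroup) :
    groupEmpRisk l S g h ∈ Set.Icc (0 : ℝ) 1 := by
  have h1 := countIn_lossEvent_one hl h g S
  have h2 : (countIn (lossEvent l h g 1) S : ℝ) ≤ groupSize S g := by
    rw [← countIn_add_countIn hl h g S]
    push_cast
    linarith [Nat.cast_nonneg (α := ℝ) (countIn (lossEvent l h g 0) S)]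
  rw [groupEmpRisk, ← h1, one_div_mul_eq_div]
  exact ⟨by positivity, div_le_one_of_le₀ h2 (Nat.cast_nonneg _)⟩

variable [MeasurableSpace X] [MeasurableSpace Y]

theorem measurableSet_group (g : SensitiveGroup) :
    MeasurableSet {z : X × SensitiveGroup × Y | z.2.1 = g} :=
  (measurable_fst.comp measurable_snd) (MeasurableSpace.measurableSet_top (s := {g}))

theorem measurableSet_lossEvent {l : Y' → Y → ℝ} {h : X → Y'}
    (hh : Measurable (fun z : X × Y => l (h z.1) z.2)) (g : SensitiveGroup) (c : ℝ) :
    MeasurableSet (lossEvent l h g c) :=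
  (measurableSet_group g).inter
    (hh.comp (measurable_fst.prodMk (measurable_snd.comp measurable_snd))
      (measurableSet_singleton c))

theorem risk_groupDist_eq {l : Y' → Y → ℝ} (hl : ∀ y' y, l y' y = 0 ∨ l y' y = 1) {h : X → Y'}
    (hh : Measurable (fun z : X × Y => l (h z.1) z.2)) (D : Measure (X × SensitiveGroup × Y))
    [IsProbabilityMeasure D] (g : SensitiveGroup) :
    risk l (groupDist D g) h = (D[lossEvent l h g 1 | {z | z.2.1 = g}]).toReal := by
  have hproj : Measurable (fun z : X × SensitiveGroup × Y => (z.1, z.2.2)) :=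
    measurable_fst.prodMk (measurable_snd.comp measurable_snd)
  have hL : MeasurableSet {z : X × SensitiveGroup × Y | l (h z.1) z.2.2 = 1} :=
    hh.comp hproj (measurableSet_singleton 1)
  rw [risk, groupDist, integral_map hproj.aemeasurable hh.aestronglyMeasurable]
  have h1 : (fun z : X × SensitiveGroup × Y => l (h z.1) z.2.2)
      = {z : X × SensitiveGroup × Y | l (h z.1) z.2.2 = 1}.indicator (fun _ => (1 : ℝ)) := by
    ext z
    rcases hl (h z.1) z.2.2 with h0 | h0 <;> simp [h0]
  have h2 : D[lossEvent l h g 1 | {z | z.2.1 = g}]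
      = D[{z | l (h z.1) z.2.2 = 1} | {z | z.2.1 = g}] := by
    rw [← cond_inter_self (measurableSet_group g) {z | l (h z.1) z.2.2 = 1}]
    rfl
  simp only
  rw [h1, integral_indicator_const _ hL, h2]
  simp [measureReal_def]

/-- Within a group the 0/1 loss is Bernoulli with the risk as parameter. A null group needs no
separate case, as all the measures involved vanish. -/
theorem measure_lossEvent {l : Y' → Y → ℝ} (hl : ∀ y' y, l y' y = 0 ∨ l y' y = 1) {h : X → Y'}
    (hh : Measurable (fun z : X × Y => l (h z.1) z.2)) (D : Measure (X × SensitiveGroup × Y))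
    [IsProbabilityMeasure D] (g : SensitiveGroup) :
    D (lossEvent l h g 1) = D {z | z.2.1 = g} * ENNReal.ofReal (risk l (groupDist D g) h) ∧
    D (lossEvent l h g 0) = D {z | z.2.1 = g} * ENNReal.ofReal (1 - risk l (groupDist D g) h) := by
  have hU := lossEvent_union hl h g
  have h1 : D (lossEvent l h g 1)
      = D {z | z.2.1 = g} * ENNReal.ofReal (risk l (groupDist D g) h) := by
    rw [risk_groupDist_eq hl hh, ENNReal.ofReal_toReal (measure_ne_top _ _), mul_comm,
      cond_mul_eq_inter (measurableSet_group g), Set.inter_eq_right.2]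
    exact fun z hz => hz.1
  refine ⟨h1, ?_⟩
  have h2 := measure_union (μ := D) (disjoint_lossEvent l h g) (measurableSet_lossEvent hh g 0)
  have h3 : 0 ≤ risk l (groupDist D g) h := by
    rw [risk_groupDist_eq hl hh]
    exact ENNReal.toReal_nonneg
  rw [ENNReal.ofReal_sub _ h3, ENNReal.ofReal_one,
    ENNReal.mul_sub (fun _ _ => measure_ne_top _ _), ← h1, mul_one, ← hU, h2,
    ENNReal.add_sub_cancel_left (measure_ne_top _ _)]

theorem risk_mem_Icc {l : Y' → Y → ℝ} (hl : ∀ y' y, l y' y = 0 ∨ l y' y = 1) {h : X → Y'}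
    (hh : Measurable (fun z : X × Y => l (h z.1) z.2)) (D : Measure (X × SensitiveGroup × Y))
    [IsProbabilityMeasure D] (g : SensitiveGroup) :
    risk l (groupDist D g) h ∈ Set.Icc (0 : ℝ) 1 := by
  rw [risk_groupDist_eq hl hh]
  exact ⟨ENNReal.toReal_nonneg, ENNReal.toReal_le_of_le_ofReal zero_le_one
    (by simpa using prob_le_one)⟩

/-- The integrand of the exponential moment that controls the deviation of the empirical risk of
`h` in the group `g` from its true risk. -/
noncomputable def expDeviation (l : Y' → Y → ℝ) (D : Measure (X × SensitiveGroup × Y))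
    (g : SensitiveGroup) {m : ℕ} (h : X → Y') (S : Fin m → X × SensitiveGroup × Y) : ENNReal :=
  ENNReal.ofReal (Real.exp (2 * (groupSize S g : ℝ)
    * (groupEmpRisk l S g h - risk l (groupDist D g) h) ^ 2) / (2 * √(groupSize S g : ℝ)))

theorem lintegral_expDeviation_le {l : Y' → Y → ℝ} (hl : ∀ y' y, l y' y = 0 ∨ l y' y = 1)
    {h : X → Y'} (hh : Measurable (fun z : X × Y => l (h z.1) z.2))
    (D : Measure (X × SensitiveGroup × Y)) [IsProbabilityMeasure D] (g : SensitiveGroup) (m : ℕ) :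
    ∫⁻ S : Fin m → _, expDeviation l D g h S ∂(Measure.pi fun _ => D) ≤ 1 := by
  obtain ⟨hp0, hp1⟩ := risk_mem_Icc hl hh D g
  obtain ⟨hA, hB⟩ := measure_lossEvent hl hh D g
  rw [← lossEvent_union hl h g] at hA hB
  refine le_trans (le_of_eq (lintegral_congr fun S => ?_)) (lintegral_exp_sq_countIn_le
    (measurableSet_lossEvent hh g 1) (measurableSet_lossEvent hh g 0)
    (disjoint_lossEvent l h g) hp0 hp1 hA hB m)
  have h1 : (groupSize S g : ℝ) = (countIn (lossEvent l h g 1) S : ℝ)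
      + countIn (lossEvent l h g 0) S := by
    rw [← countIn_add_countIn hl h g S]
    push_cast
    rfl
  rw [expDeviation, groupEmpRisk, ← countIn_lossEvent_one hl h g S, h1, one_div_mul_eq_div]

/-! ### Joint measurability in classifier and sample -/

section Measurability

variable {H : Set (X → Y')} [MeasurableSpace H]

theorem measurable_groupSize (g : SensitiveGroup) (m : ℕ) :
    Measurable (fun S : Fin m → X × SensitiveGroup × Y => (groupSize S g : ℝ)) := by
  have : (fun S : Fin m → X × SensitiveGroup × Y => (groupSize S g : ℝ))
      = fun S => ∑ i, {z : X × SensitiveGroup × Y | z.2.1 = g}.indicator (fun _ => 1) (S i) := by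
    ext S
    rw [groupSize, groupIdx, Finset.card_filter]
    push_cast
    simp [Set.indicator_apply]
  rw [this]
  exact Finset.measurable_sum _ fun i _ =>
    (measurable_const.indicator (measurableSet_group g)).comp (measurable_pi_apply i)

theorem measurable_groupEmpRisk {l : Y' → Y → ℝ}
    (hmeas : Measurable (fun p : H × X × Y => l ((p.1 : X → Y') p.2.1) p.2.2))
    (g : SensitiveGroup) (m : ℕ) :
    Measurable (fun p : H × (Fin m → X × SensitiveGroup × Y) =>
      groupEmpRisk l p.2 g (p.1 : X → Y')) := by
  refine Measurable.mul (measurable_const.div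
    ((measurable_groupSize g m).comp measurable_snd)) ?_
  simp only [groupIdx, Finset.sum_filter]
  refine Finset.measurable_sum _ fun i _ => ?_
  have hi : Measurable (fun p : H × (Fin m → X × SensitiveGroup × Y) => p.2 i) :=
    (measurable_pi_apply i).comp measurable_snd
  refine Measurable.ite (hi (measurableSet_group g)) ?_ measurable_const
  exact hmeas.comp (measurable_fst.prodMk (hi.fst.prodMk hi.snd.snd))

theorem measurable_risk {l : Y' → Y → ℝ}
    (hmeas : Measurable (fun p : H × X × Y => l ((p.1 : X → Y') p.2.1) p.2.2))
    (P : Measure (X × Y)) [SFinite P] : Measurable (fun h : H => risk l P (h : X → Y')) :=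
  (StronglyMeasurable.integral_prod_right
    (f := fun (h : H) (z : X × Y) => l ((h : X → Y') z.1) z.2) hmeas.stronglyMeasurable).measurable

instance (D : Measure (X × SensitiveGroup × Y)) [IsFiniteMeasure D] (g : SensitiveGroup) :
    IsFiniteMeasure (groupDist D g) := by
  unfold groupDist
  infer_instance

theorem measurable_expDeviation {l : Y' → Y → ℝ}
    (hmeas : Measurable (fun p : H × X × Y => l ((p.1 : X → Y') p.2.1) p.2.2))
    (D : Measure (X × SensitiveGroup × Y)) [IsProbabilityMeasure D] (g : SensitiveGroup) (m : ℕ) :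
    Measurable (fun p : H × (Fin m → X × SensitiveGroup × Y) =>
      expDeviation l D g (p.1 : X → Y') p.2) := by
  have h1 := measurable_groupEmpRisk hmeas g m
  have h2 : Measurable (fun p : H × (Fin m → X × SensitiveGroup × Y) =>
      risk l (groupDist D g) (p.1 : X → Y')) :=
    (measurable_risk hmeas (groupDist D g)).comp measurable_fst
  have h3 : Measurable (fun p : H × (Fin m → X × SensitiveGroup × Y) => (groupSize p.2 g : ℝ)) :=
    (measurable_groupSize g m).comp measurable_snd
  exact (((h3.const_mul 2).mul ((h1.sub h2).pow_const 2)).exp.div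
    (h3.sqrt.const_mul 2)).ennreal_ofReal

end Measurability

/-! ### PAC-Bayes bound for one group -/

section PacBayes

variable {H : Set (X → Y')} [MeasurableSpace H] {l : Y' → Y → ℝ}

/-- The samples for which the prior mean of the exponential deviation in the group `g` is at
most `2 / δ`. -/
def goodSamples (l : Y' → Y → ℝ) (D : Measure (X × SensitiveGroup × Y)) (π : Measure H) (δ : ℝ)
    (m : ℕ) (g : SensitiveGroup) : Set (Fin m → X × SensitiveGroup × Y) :=
  {S | ∫⁻ h : H, expDeviation l D g (h : X → Y') S ∂π < ENNReal.ofReal (2 / δ)}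

theorem measurable_lintegral_expDeviation
    (hmeas : Measurable (fun p : H × X × Y => l ((p.1 : X → Y') p.2.1) p.2.2))
    (D : Measure (X × SensitiveGroup × Y)) [IsProbabilityMeasure D] (π : Measure H)
    [IsProbabilityMeasure π] (m : ℕ) (g : SensitiveGroup) :
    Measurable (fun S : Fin m → X × SensitiveGroup × Y =>
      ∫⁻ h : H, expDeviation l D g (h : X → Y') S ∂π) :=
  Measurable.lintegral_prod_left' (measurable_expDeviation hmeas D g m)

theorem measurableSet_goodSamples
    (hmeas : Measurable (fun p : H × X × Y => l ((p.1 : X → Y') p.2.1) p.2.2))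
    (D : Measure (X × SensitiveGroup × Y)) [IsProbabilityMeasure D] (π : Measure H)
    [IsProbabilityMeasure π] (δ : ℝ) (m : ℕ) (g : SensitiveGroup) :
    MeasurableSet (goodSamples l D π δ m g) :=
  measurableSet_lt (measurable_lintegral_expDeviation hmeas D π m g) measurable_const

/-- The prior does not depend on the sample, so Tonelli carries the mean bound from each classifier
to the prior average; Markov at level `2 / δ` finishes. -/
theorem measureReal_compl_goodSamples_le (hl : ∀ y' y, l y' y = 0 ∨ l y' y = 1)
    (hmeas : Measurable (fun p : H × X × Y => l ((p.1 : X → Y') p.2.1) p.2.2))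
    (D : Measure (X × SensitiveGroup × Y)) [IsProbabilityMeasure D] (π : Measure H)
    [IsProbabilityMeasure π] {δ : ℝ} (hδ : 0 < δ) (m : ℕ) (g : SensitiveGroup) :
    (Measure.pi (fun _ : Fin m => D)).real (goodSamples l D π δ m g)ᶜ ≤ δ / 2 := by
  have hmean : ∫⁻ S : Fin m → _, ∫⁻ h : H, expDeviation l D g (h : X → Y') S ∂π
      ∂(Measure.pi fun _ => D) ≤ 1 := by
    rw [lintegral_lintegral_swap
      (f := fun (S : Fin m → X × SensitiveGroup × Y) (h : H) => expDeviation l D g (h : X → Y') S)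
      ((measurable_expDeviation hmeas D g m).comp measurable_swap).aemeasurable]
    refine (lintegral_mono fun h : H => lintegral_expDeviation_le hl
      (hmeas.comp (measurable_const.prodMk measurable_id)) D g m).trans ?_
    simp
  have hmarkov := meas_ge_le_lintegral_div (μ := Measure.pi fun _ : Fin m => D)
    (measurable_lintegral_expDeviation hmeas D π m g).aemeasurable
    (ε := ENNReal.ofReal (2 / δ)) (by simpa using hδ) ENNReal.ofReal_ne_top
  have hset : (goodSamples l D π δ m g)ᶜ = {S | ENNReal.ofReal (2 / δ)
      ≤ ∫⁻ h : H, expDeviation l D g (h : X → Y') S ∂π} := by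
    ext S
    simp [goodSamples]
  rw [hset, measureReal_def]
  refine ENNReal.toReal_le_of_le_ofReal (by positivity) (hmarkov.trans ?_)
  refine (ENNReal.div_le_div_right hmean _).trans (le_of_eq ?_)
  rw [one_div, ← ENNReal.ofReal_inv_of_pos (by positivity), inv_div]

/-- The good event involves only the prior, so one sample serves every posterior. The constant 4 is
the regret factor 2 times the 2 in `2 / δ`. -/
theorem abs_gibbsRisk_sub_le (hl : ∀ y' y, l y' y = 0 ∨ l y' y = 1)
    (hmeas : Measurable (fun p : H × X × Y => l ((p.1 : X → Y') p.2.1) p.2.2))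
    (D : Measure (X × SensitiveGroup × Y)) [IsProbabilityMeasure D] {π : Measure H}
    [IsProbabilityMeasure π] {δ : ℝ} (hδ : 0 < δ) {m : ℕ} {g : SensitiveGroup}
    {S : Fin m → X × SensitiveGroup × Y} (hS : S ∈ goodSamples l D π δ m g)
    (hg : 0 < groupSize S g) (ρ : Measure H) [IsProbabilityMeasure ρ] (hkl : klDiv ρ π ≠ ⊤) :
    |groupGibbsEmpRisk l S g ρ - gibbsRisk l (groupDist D g) ρ|
      ≤ √(((klDiv ρ π).toReal + Real.log (4 * √(groupSize S g : ℝ) / δ))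
          / (2 * (groupSize S g : ℝ))) := by
  have hR : ∀ h : H, risk l (groupDist D g) (h : X → Y') ∈ Set.Icc (0 : ℝ) 1 := fun h =>
    risk_mem_Icc hl (hmeas.comp (measurable_const.prodMk measurable_id)) D g
  have hE : ∀ h : H, groupEmpRisk l S g (h : X → Y') ∈ Set.Icc (0 : ℝ) 1 := fun h =>
    groupEmpRisk_mem_Icc hl h S g
  have hRm := measurable_risk hmeas (groupDist D g)
  have hEm : Measurable (fun h : H => groupEmpRisk l S g (h : X → Y')) :=
    (measurable_groupEmpRisk hmeas g m).of_uncurry_right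
      (f := fun (h : H) S => groupEmpRisk l S g (h : X → Y'))
  have hint : ∀ f : H → ℝ, Measurable f → (∀ h, f h ∈ Set.Icc (0 : ℝ) 1) → Integrable f ρ := by
    intro f hf h01
    refine Integrable.of_bound hf.aestronglyMeasurable 1 (ae_of_all _ fun h => ?_)
    rw [Real.norm_of_nonneg (h01 h).1]
    exact (h01 h).2
  rw [groupGibbsEmpRisk, gibbsRisk, ← integral_sub (hint _ hEm hE) (hint _ hRm hR),
    show 4 * √(groupSize S g : ℝ) / δ = 2 * √(groupSize S g : ℝ) * (2 / δ) by ring]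
  have hf1 : ∀ h : H, |groupEmpRisk l S g (h : X → Y') - risk l (groupDist D g) h| ≤ 1 := by
    intro h
    rw [abs_le]
    constructor <;> linarith [(hR h).1, (hR h).2, (hE h).1, (hE h).2]
  exact abs_integral_le_sqrt hkl (hEm.sub hRm) hf1 (Nat.cast_pos.2 hg) (by positivity)
    (le_of_lt hS)

end PacBayes

end FairRisk

/-! ### Combining the two groups -/

theorem mainTheorem7 {X Y Y' : Type*} [MeasurableSpace X] [MeasurableSpace Y]
    (l : Y' → Y → ℝ) (hl : ∀ y' y, l y' y = 0 ∨ l y' y = 1)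
    (D : Measure (X × SensitiveGroup × Y)) [IsProbabilityMeasure D]
    (H : Set (X → Y')) [MeasurableSpace H]
    (hmeas : Measurable (fun p : H × X × Y => l ((p.1 : X → Y') p.2.1) p.2.2))
    (π : Measure H) [IsProbabilityMeasure π]
    (δ : ℝ) (hδ0 : 0 < δ) (hδ1 : δ ≤ 1) (m : ℕ) :
    ∃ E : Set (Fin m → X × SensitiveGroup × Y), MeasurableSet E ∧
      1 - δ ≤ (Measure.pi (fun _ : Fin m => D)).real E ∧
      ∀ S ∈ E,
        0 < FairRisk.groupSize S SensitiveGroup.a →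
        0 < FairRisk.groupSize S SensitiveGroup.b →
        ∀ ρ : Measure H, IsProbabilityMeasure ρ → klDiv ρ π ≠ ⊤ →
          FairRisk.gibbsFairRisk l D ρ ≤
            |FairRisk.groupGibbsEmpRisk l S SensitiveGroup.b ρ
              - FairRisk.groupGibbsEmpRisk l S SensitiveGroup.a ρ|
            + √(((klDiv ρ π).toReal
                + Real.log (4 * √(FairRisk.groupSize S SensitiveGroup.a : ℝ) / δ))
                / (2 * (FairRisk.groupSize S SensitiveGroup.a : ℝ)))
            + √(((klDiv ρ π).toReal
                + Real.log (4 * √(FairRisk.groupSize S SensitiveGroup.b : ℝ) / δ))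
                / (2 * (FairRisk.groupSize S SensitiveGroup.b : ℝ))) := by
  refine ⟨FairRisk.goodSamples l D π δ m SensitiveGroup.a
      ∩ FairRisk.goodSamples l D π δ m SensitiveGroup.b,
    (FairRisk.measurableSet_goodSamples hmeas D π δ m _).inter
      (FairRisk.measurableSet_goodSamples hmeas D π δ m _), ?_, ?_⟩
  · have hA := FairRisk.measureReal_compl_goodSamples_le hl hmeas D π hδ0 m SensitiveGroup.a
    have hB := FairRisk.measureReal_compl_goodSamples_le hl hmeas D π hδ0 m SensitiveGroup.b
    have hAB := measureReal_union_le (μ := Measure.pi (fun _ : Fin m => D))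
      (FairRisk.goodSamples l D π δ m SensitiveGroup.a)ᶜ
      (FairRisk.goodSamples l D π δ m SensitiveGroup.b)ᶜ
    rw [← Set.compl_inter, probReal_compl_eq_one_sub
      ((FairRisk.measurableSet_goodSamples hmeas D π δ m _).inter
        (FairRisk.measurableSet_goodSamples hmeas D π δ m _))] at hAB
    linarith
  · rintro S ⟨hSa, hSb⟩ ha hb ρ hρ hkl
    have hA := FairRisk.abs_gibbsRisk_sub_le hl hmeas D hδ0 hSa ha ρ hkl
    have hB := FairRisk.abs_gibbsRisk_sub_le hl hmeas D hδ0 hSb hb ρ hkl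
    rw [abs_sub_comm] at hA
    rw [FairRisk.gibbsFairRisk, abs_sub_comm (FairRisk.groupGibbsEmpRisk l S SensitiveGroup.b ρ)]
    refine le_trans ?_ (add_le_add (add_le_add_right hA _) hB)
    -- With `r` for empirical risks, `R_a - R_b = (r_a - r_b) + (R_a - r_a) + (r_b - R_b)`.
    refine le_trans (le_of_eq ?_) ((abs_add_le _ _).trans (add_le_add_left (abs_add_le _ _) _))
    congr 1
    ring
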